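/- **Setting.** Let $n$ clients hold vectors $z_1,\dots,z_n\in\mathbb{R}^d$. A *$K$-round SecAgg-compatible protocol* $\mathcal{A}$ runs as follows. In round $t=1,\dots,K$ there is a finite abelian group $\mathcal{O}_t$ (for instance the additive group of a finite field); each client $i$ encodes $z_i$ as an element of $\mathcal{O}_t$ by a (possibly randomized, measurable) encoder, and the server learns only the sum $O_t\in\mathcal{O}_t$ of the $n$ messages. The group $\mathcal{O}_t$ and the encoders of round $t$ may depend on $O_1,\dots,O_{t-1}$; in particular $\mathcal{O}_1$ is fixed in advance. After $K$ rounds a (possibly randomized) decoder outputs $\mathcal{A}(z_1,\dots,z_n)\in\mathbb{R}^d$ as a function of $O_1,\dots,O_K$. The randomness of the protocol (which may be shared) is independent of the data. The total per-client communication is $\sum_{t=1}^K\log_2|\mathcal{O}_t|$ bits. For $G>0$ let $\mathcal{P}_2(d,G)$ be the set of probability distributions $\mathcal{D}$ on $\mathbb{R}^d$ with $\|z\|\le G$ for $\mathcal D$-almost every $z$, and let $\mu(\mathcal{D})$ be the mean of $\mathcal{D}$. The protocol is *unbiased* if $\mathbb{E}_{D\sim\mathcal{D}^n}[\mathcal{A}(D)]=\mu(\mathcal{D})$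 (with integrability) for all $\mathcal{D}\in\mathcal{P}_2(d,G)$. Put $$\alpha=\frac{G^2}{n}+\frac{G^2d\log(1/\delta)}{n^2\varepsilon^2},\qquad B(m)=\min\Big(d,\ \frac{m^2n^2\varepsilon^2}{\log(1/\delta)},\ m^2nd\Big).$$ **Theorem (interaction is necessary).** Let $K,d,n$ be integers with $K\ge0$, $d\ge1$, $n\ge2$, let $G,\varepsilon>0$ and $0<\delta<1$, and let $\mathcal{A}$ be a $K$-round unbiased SecAgg-compatible protocol. 1. If there are constants $C_1,C_2$ such that for every $\mathcal{D}\in\mathcal{P}_2(d,G)$, on $D\sim\mathcal{D}^n$, one has $\mathbb{E}\|\mathcal{A}(D)-\mu(\mathcal{D})\|^2\le C_1\min(\|\mu(\mathcal{D})\|^2,\alpha)$, and with probability $>\frac1n$ the total per-client communication is at most $C_2\,B(\|\mu(\mathcal{D})\|)$ bits, then $K\ge2$. 2. There is an absolute constant $c>0$ (independent of all the parameters and of $\mathcal{A}$) such that the same conclusion $K\ge 2$ holds under the following weaker hypotheses: for some constants $C_1\ge1$, $C_2$ and some $s<\frac{c}{C_1}B(1)$, for every $\mathcal{D}\in\mathcal{P}_2(d,G)$,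 on $D\sim\mathcal{D}^n$, one has $\mathbb{E}\|\mathcal{A}(D)-\mu(\mathcal{D})\|^2\le C_1\alpha$, and with probability $>\frac1n$ the total per-client communication is at most $C_2\,B(\|\mu(\mathcal{D})\|/G)+s$ bits. So one-round protocols cannot adapt their communication to the norm of the mean. -/

import Mathlib

open MeasureTheory
open scoped ENNReal

universe u

/-- A `K`-round protocol with secure aggregation for `n` clients holding vectors of `ℝ^d`, with all
randomness of the encoders and of the decoder carried by `Ω`, written as a protocol tree.

With no round left, the server decodes.  A round consists of a finite abelian group `O` over which
secure aggregation operates (for instance the additive group of a finite field), an encoder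
`enc i ω : ℝ^d → O` for each client `i`, and, for each value `o : O` of the aggregate
`∑ i, enc i ω (z i)` (all that the server sees of the messages), the rest of the protocol.
Hence the message space, the encoders and the decoder of a round may depend on the aggregates of the
earlier rounds, and the message space of the first round is fixed in advance. -/
inductive SecAggProtocol (Ω : Type u) [MeasurableSpace Ω] (n d : ℕ) : ℕ → Type (max u 1)
  | decode (U : Ω → EuclideanSpace ℝ (Fin d)) (hU : Measurable U) : SecAggProtocol Ω n d 0
  | round {K : ℕ} (O : Type) [AddCommGroup O] [Fintype O]
      (enc : Fin n → Ω → EuclideanSpace ℝ (Fin d) → O)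
      (henc : ∀ i o, MeasurableSet {p : Ω × EuclideanSpace ℝ (Fin d) | enc i p.1 p.2 = o})
      (next : O → SecAggProtocol Ω n d K) : SecAggProtocol Ω n d (K + 1)

namespace SecAggProtocol

variable {Ω : Type u} [MeasurableSpace Ω] {n d : ℕ}

/-- The estimate that the protocol outputs on the dataset `z`, with randomness `ω`. -/
def output : {K : ℕ} → SecAggProtocol Ω n d K → Ω → (Fin n → EuclideanSpace ℝ (Fin d)) →
    EuclideanSpace ℝ (Fin d)
  | _, decode U _, ω, _ => U ω
  | _, round _ enc _ next, ω, z => (next (∑ i, enc i ω (z i))).output ω z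

/-- The total per-client communication, in bits: the sum over the rounds of `log₂ |O|`. -/
noncomputable def bits : {K : ℕ} → SecAggProtocol Ω n d K → Ω →
    (Fin n → EuclideanSpace ℝ (Fin d)) → ℝ
  | _, decode _ _, _, _ => 0
  | _, round O enc _ next, ω, z =>
      Real.logb 2 (Fintype.card O) + (next (∑ i, enc i ω (z i))).bits ω z

end SecAggProtocol

/-- The probability distributions on `ℝ^d` supported in the ball of radius `G`. -/
def boundedDistributions (d : ℕ) (G : ℝ) : Set (Measure (EuclideanSpace ℝ (Fin d))) :=
  {D | IsProbabilityMeasure D ∧ ∀ᵐ z ∂D, ‖z‖ ≤ G}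

/-- The mean of a distribution. -/
noncomputable def distMean {d : ℕ} (D : Measure (EuclideanSpace ℝ (Fin d))) :
    EuclideanSpace ℝ (Fin d) := ∫ z, z ∂D

/-- The joint law of the randomness of the protocol and of `n` i.i.d. samples from `D`. -/
noncomputable def runLaw {Ω : Type u} [MeasurableSpace Ω] (P : Measure Ω) (n : ℕ) {d : ℕ}
    (D : Measure (EuclideanSpace ℝ (Fin d))) :
    Measure (Ω × (Fin n → EuclideanSpace ℝ (Fin d))) :=
  P.prod (Measure.pi fun _ => D)

/-- The error rate `G²/n + G² d log(1/δ) / (n² ε²)`. -/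
noncomputable def errorRate (d n : ℕ) (G ε δ : ℝ) : ℝ :=
  G ^ 2 / n + G ^ 2 * d * Real.log (1 / δ) / (n ^ 2 * ε ^ 2)

/-- The communication budget `min (d, m² n² ε² / log(1/δ), m² n d)` for a mean of norm `m`. -/
noncomputable def commBudget (d n : ℕ) (ε δ m : ℝ) : ℝ :=
  min (d : ℝ) (min (m ^ 2 * n ^ 2 * ε ^ 2 / Real.log (1 / δ)) (m ^ 2 * n * d))

namespace SecAggProtocol

variable {Ω : Type u} [MeasurableSpace Ω] {n d K : ℕ}

/-- The output is an unbiased estimate of the mean of every distribution bounded by `G`. -/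
def Unbiased (A : SecAggProtocol Ω n d K) (P : Measure Ω) (G : ℝ) : Prop :=
  ∀ D ∈ boundedDistributions d G,
    Integrable (fun x : Ω × (Fin n → EuclideanSpace ℝ (Fin d)) => A.output x.1 x.2)
      (runLaw P n D) ∧
    ∫ x, A.output x.1 x.2 ∂(runLaw P n D) = distMean D

/-- The mean squared error of the protocol on `n` i.i.d. samples from `D`. -/
noncomputable def mse (A : SecAggProtocol Ω n d K) (P : Measure Ω)
    (D : Measure (EuclideanSpace ℝ (Fin d))) : ℝ≥0∞ :=
  ∫⁻ x, ENNReal.ofReal (‖A.output x.1 x.2 - distMean D‖ ^ 2) ∂(runLaw P n D)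

/-- The probability that the total per-client communication on `n` i.i.d. samples from `D` is at
most `b` bits. -/
noncomputable def probBitsLE (A : SecAggProtocol Ω n d K) (P : Measure Ω)
    (D : Measure (EuclideanSpace ℝ (Fin d))) (b : ℝ) : ℝ :=
  (runLaw P n D).real {x | A.bits x.1 x.2 ≤ b}

end SecAggProtocol

open scoped RealInnerProductSpace

/-! A one-round protocol fixes its message group `O` before seeing any data, so its cost is one
number. The point mass at `0` leaves no budget for a mean of norm `0`, so that number is at most
`0`, respectively `s`. With `|O| = 1` the output ignores the data and cannot be unbiased; this
settles the first part, and zero rounds in both.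

For the second part, let all clients hold the same vector `(G / √d) • σ` with `σ` a sign vector. For
fixed randomness the output is one of `N = |O|` codewords, so the protocol is an unbiased randomized
quantizer. Unbiasedness forces average correlation `G √d` between output and `σ`. But the best of
`N` unit vectors correlates with random signs only to order `√(log N)`, so by Cauchy–Schwarz the
second moment of the output is at least of order `G² d / log N` (`sq_mul_le_of_unbiased_quantizer`).
The error bound caps this moment, hence `log N` is at least a fixed fraction of the worst-case
budget over `C₁` (`errorRate_mul_commBudget_le`), more than `s` allows. -/

/-! ### Correlation of finite codebooks with random signs -/

/-- The vector of `ℝ^d` with entries `±1` given by `σ`. -/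
noncomputable def signVector {d : ℕ} (σ : Fin d → Bool) : EuclideanSpace ℝ (Fin d) :=
  WithLp.toLp 2 fun i => if σ i then 1 else -1

lemma norm_signVector_sq {d : ℕ} (σ : Fin d → Bool) : ‖signVector σ‖ ^ 2 = d := by
  rw [EuclideanSpace.norm_sq_eq]
  have h : ∀ i, ‖signVector σ i‖ ^ 2 = 1 := fun i => by
    simp only [signVector]
    split_ifs <;> norm_num
  rw [Finset.sum_congr rfl fun i _ => h i]
  simp

/-- Random signs are sub-Gaussian. -/
lemma sum_exp_inner_signVector_le {d : ℕ} (u : EuclideanSpace ℝ (Fin d)) :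
    ∑ σ : Fin d → Bool, Real.exp ⟪u, signVector σ⟫ ≤ 2 ^ d * Real.exp (‖u‖ ^ 2 / 2) := by
  have hexp : ∀ σ : Fin d → Bool, Real.exp ⟪u, signVector σ⟫ =
      ∏ i, Real.exp (if σ i then u i else -u i) := fun σ => by
    rw [← Real.exp_sum, PiLp.inner_apply]
    congr 1
    refine Finset.sum_congr rfl fun i _ => ?_
    simp only [signVector]
    split_ifs <;> simp
  have hprod : ∏ i, ∑ b : Bool, Real.exp (if b then u i else -u i) =
      ∑ σ : Fin d → Bool, ∏ i, Real.exp (if σ i then u i else -u i) := by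
    rw [Finset.prod_univ_sum, Fintype.piFinset_univ]
  simp_rw [hexp]
  rw [← hprod]
  have hcosh : ∀ i, ∑ b : Bool, Real.exp (if b then u i else -u i) = 2 * Real.cosh (u i) :=
    fun i => by
      rw [Real.cosh_eq]
      simp
      ring
  calc ∏ i, ∑ b : Bool, Real.exp (if b then u i else -u i)
      = ∏ i, 2 * Real.cosh (u i) := Finset.prod_congr rfl fun i _ => hcosh i
    _ ≤ ∏ i, 2 * Real.exp (u i ^ 2 / 2) := by
        refine Finset.prod_le_prod (fun i _ => ?_) fun i _ => ?_
        · have := Real.cosh_pos (u i)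
          positivity
        · have := Real.cosh_le_exp_half_sq (u i)
          linarith
    _ = 2 ^ d * Real.exp (‖u‖ ^ 2 / 2) := by
        rw [Finset.prod_mul_distrib, ← Real.exp_sum, EuclideanSpace.norm_sq_eq, Finset.sum_div]
        simp

/-- If `N` vectors of the unit ball are correlated with random signs, the maximal correlation is
bounded by a random variable `R` with second moment of order `log N`. -/
lemma exists_sum_sq_le_and_inner_signVector_le {d : ℕ} {ι : Type*} [Fintype ι]
    (hι : 2 ≤ Fintype.card ι) (u : ι → EuclideanSpace ℝ (Fin d)) (hu : ∀ o, ‖u o‖ ≤ 1) :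
    ∃ R : (Fin d → Bool) → ℝ,
      (∀ σ o, ⟪u o, signVector σ⟫ ≤ R σ) ∧
      ∑ σ, R σ ^ 2 ≤ 13 * Real.log (Fintype.card ι) * 2 ^ d := by
  set N : ℝ := (Fintype.card ι : ℝ) with hN
  have hN2 : (2 : ℝ) ≤ N := by rw [hN]; exact_mod_cast hι
  set L := Real.log N with hL
  have hL2 : 0.69 < L := by
    have := Real.log_two_gt_d9
    have := Real.log_le_log two_pos hN2
    linarith
  have hL0 : 0 < L := by linarith
  set β := √L with hβ
  have hβ0 : 0 < β := Real.sqrt_pos.2 hL0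
  have hβ2 : β ^ 2 = L := Real.sq_sqrt hL0.le
  have hexpL : Real.exp L = N := Real.exp_log (by linarith)
  -- Exponential weights dominating all codewords at once. The shift `2 * L` makes the mean of `W ^
  -- 2` at most `N * N * exp (-4L) * exp (2L) = 1`: one `N` from Cauchy–Schwarz, one from the sum
  -- over `o`, and `exp (2L)` from sub-Gaussianity at `2β` with `β² = L`.
  set W : (Fin d → Bool) → ℝ := fun σ => ∑ o, Real.exp (β * ⟪u o, signVector σ⟫ - 2 * L) with hW
  have hWsq : ∑ σ, W σ ^ 2 ≤ 2 ^ d := by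
    have h1 : ∀ σ, W σ ^ 2 ≤
        ∑ o, N * (Real.exp (-(4 * L)) * Real.exp ⟪(2 * β) • u o, signVector σ⟫) := fun σ => by
      refine (sq_sum_le_card_mul_sum_sq).trans_eq ?_
      rw [Finset.card_univ, ← hN, Finset.mul_sum]
      refine Finset.sum_congr rfl fun o _ => ?_
      rw [← Real.exp_nat_mul, ← Real.exp_add, real_inner_smul_left]
      congr 2
      push_cast
      ring
    have h2 : ∀ o, ∑ σ : Fin d → Bool, Real.exp ⟪(2 * β) • u o, signVector σ⟫ ≤
        2 ^ d * Real.exp (2 * L) := fun o => by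
      refine (sum_exp_inner_signVector_le _).trans ?_
      gcongr
      rw [norm_smul, mul_pow, Real.norm_eq_abs, sq_abs]
      have := mul_le_mul_of_nonneg_left (pow_le_one₀ (n := 2) (norm_nonneg _) (hu o)) hL0.le
      nlinarith
    calc ∑ σ, W σ ^ 2
        ≤ ∑ σ, ∑ o, N * (Real.exp (-(4 * L)) * Real.exp ⟪(2 * β) • u o, signVector σ⟫) :=
          Finset.sum_le_sum fun σ _ => h1 σ
      _ = ∑ o, N * (Real.exp (-(4 * L)) *
            ∑ σ : Fin d → Bool, Real.exp ⟪(2 * β) • u o, signVector σ⟫) := by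
          rw [Finset.sum_comm]
          simp_rw [Finset.mul_sum]
      _ ≤ ∑ _o : ι, N * (Real.exp (-(4 * L)) * (2 ^ d * Real.exp (2 * L))) := by
          gcongr with o
          exact h2 o
      _ = 2 ^ d * (Real.exp L * Real.exp L * Real.exp (-(4 * L)) * Real.exp (2 * L)) := by
          rw [Finset.sum_const, Finset.card_univ, nsmul_eq_mul, ← hN, hexpL]
          ring
      _ = 2 ^ d := by
          rw [← Real.exp_add, ← Real.exp_add, ← Real.exp_add]
          ring_nf
          simp
  -- `R` solves `β * R - 2 * L = W`; it dominates each correlation because `y ≤ exp y`.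
  refine ⟨fun σ => (2 * L + W σ) / β, fun σ o => ?_, ?_⟩
  · rw [le_div_iff₀ hβ0]
    have h1 : Real.exp (β * ⟪u o, signVector σ⟫ - 2 * L) ≤ W σ :=
      Finset.single_le_sum (f := fun o => Real.exp (β * ⟪u o, signVector σ⟫ - 2 * L))
        (fun _ _ => (Real.exp_pos _).le) (Finset.mem_univ o)
    have h2 := Real.add_one_le_exp (β * ⟪u o, signVector σ⟫ - 2 * L)
    linarith
  · have h1 : ∀ σ, ((2 * L + W σ) / β) ^ 2 ≤ (8 * L ^ 2 + 2 * W σ ^ 2) / L := fun σ => by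
      rw [div_pow, hβ2]
      gcongr
      nlinarith [sq_nonneg (2 * L - W σ)]
    calc ∑ σ, ((2 * L + W σ) / β) ^ 2
        ≤ ∑ σ, (8 * L ^ 2 + 2 * W σ ^ 2) / L := Finset.sum_le_sum fun σ _ => h1 σ
      _ = (2 ^ d * (8 * L ^ 2) + 2 * ∑ σ, W σ ^ 2) / L := by
          rw [← Finset.sum_div, Finset.sum_add_distrib, ← Finset.mul_sum _ _ (2 : ℝ)]
          simp
      _ ≤ (2 ^ d * (8 * L ^ 2) + 2 * 2 ^ d) / L := by gcongr
      _ ≤ 13 * L * 2 ^ d := by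
          rw [div_le_iff₀ hL0]
          -- This gives `8L² + 2 ≤ 13L²`, the source of the constant 13; it relies on `L ≥ log 2 >
          -- 0.69`.
          have : (2 : ℝ) ≤ 5 * L ^ 2 := by nlinarith
          nlinarith [pow_pos (two_pos : (0 : ℝ) < 2) d]

/-- A codebook of `N` vectors has total correlation with all sign vectors bounded in terms of the
second moment of the codewords and `log N`. -/
lemma sum_inner_signVector_codeword_le {d : ℕ} {ι : Type*} [Fintype ι]
    (hι : 2 ≤ Fintype.card ι) (V : ι → EuclideanSpace ℝ (Fin d)) (q : (Fin d → Bool) → ι)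
    {t : ℝ} (ht : 0 < t) :
    ∑ σ, ⟪V (q σ), signVector σ⟫ ≤
      t / 2 * ∑ σ, ‖V (q σ)‖ ^ 2 + 13 * Real.log (Fintype.card ι) * 2 ^ d / (2 * t) := by
  obtain ⟨R, hR, hRsq⟩ := exists_sum_sq_le_and_inner_signVector_le hι
    -- A zero codeword is normalized to `0`, since `0⁻¹ = 0`.
    (fun o => ‖V o‖⁻¹ • V o) fun o => by
      rw [norm_smul, norm_inv, norm_norm]
      exact inv_mul_le_one
  -- Weighted AM-GM replaces Cauchy–Schwarz: the bound is linear in second moments, so it can be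
  -- integrated over the randomness with one `t`.
  have h1 : ∀ σ, ⟪V (q σ), signVector σ⟫ ≤ t / 2 * ‖V (q σ)‖ ^ 2 + R σ ^ 2 / (2 * t) := fun σ => by
    have h2 : ⟪V (q σ), signVector σ⟫ ≤ ‖V (q σ)‖ * R σ := by
      rcases eq_or_ne (V (q σ)) 0 with h0 | h0
      · simp [h0]
      · have h3 := mul_le_mul_of_nonneg_left (hR σ (q σ)) (norm_nonneg (V (q σ)))
        rwa [real_inner_smul_left, mul_inv_cancel_left₀ (norm_ne_zero_iff.2 h0)] at h3
    have h4 : t / 2 * ‖V (q σ)‖ ^ 2 + R σ ^ 2 / (2 * t) - ‖V (q σ)‖ * R σ =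
        (t * ‖V (q σ)‖ - R σ) ^ 2 / (2 * t) := by
      field_simp
      ring
    have h5 : 0 ≤ (t * ‖V (q σ)‖ - R σ) ^ 2 / (2 * t) := by positivity
    linarith
  calc ∑ σ, ⟪V (q σ), signVector σ⟫
      ≤ ∑ σ, (t / 2 * ‖V (q σ)‖ ^ 2 + R σ ^ 2 / (2 * t)) := Finset.sum_le_sum fun σ _ => h1 σ
    _ = t / 2 * ∑ σ, ‖V (q σ)‖ ^ 2 + (∑ σ, R σ ^ 2) / (2 * t) := by
        rw [Finset.sum_add_distrib, ← Finset.mul_sum, ← Finset.sum_div]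
    _ ≤ _ := by gcongr

/-! ### Second moment of unbiased quantizers -/

/-- An unbiased randomized quantizer with codebooks of size `N` of the vectors
`(G / √d) • signVector σ` has second moment at least `G² d / (13 log N)`. -/
lemma sq_mul_le_of_unbiased_quantizer {Ω : Type*} [MeasurableSpace Ω] {P : Measure Ω}
    [IsProbabilityMeasure P] {d : ℕ} (hd : 1 ≤ d) {G M : ℝ} (hG : 0 < G)
    {ι : Type*} [Fintype ι] (hι : 2 ≤ Fintype.card ι)
    (V : Ω → ι → EuclideanSpace ℝ (Fin d)) (q : Ω → (Fin d → Bool) → ι)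
    (hint : ∀ σ, Integrable (fun ω => V ω (q ω σ)) P)
    (hmean : ∀ σ, ∫ ω, V ω (q ω σ) ∂P = (G / √d) • signVector σ)
    (hint2 : ∀ σ, Integrable (fun ω => ‖V ω (q ω σ)‖ ^ 2) P)
    (hM : ∀ σ, ∫ ω, ‖V ω (q ω σ)‖ ^ 2 ∂P ≤ M) :
    G ^ 2 * d ≤ 13 * Real.log (Fintype.card ι) * M := by
  have hd0 : (0 : ℝ) < d := by exact_mod_cast hd
  have hs0 : 0 < √(d : ℝ) := Real.sqrt_pos.2 hd0
  have hs2 : √(d : ℝ) ^ 2 = d := Real.sq_sqrt hd0.le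
  set L := Real.log (Fintype.card ι) with hL
  have hL0 : 0 < L := Real.log_pos (by exact_mod_cast hι)
  -- Chosen so that the `1 / t` term is exactly half of the forced correlation `G * √d`.
  set t := 13 * L / (G * √d) with ht
  have ht0 : 0 < t := by positivity
  have hinner : ∀ σ, ∫ ω, ⟪V ω (q ω σ), signVector σ⟫ ∂P = G * √d := fun σ => by
    simp_rw [real_inner_comm (signVector σ)]
    rw [integral_inner (hint σ), hmean, real_inner_smul_right, real_inner_self_eq_norm_sq,
      norm_signVector_sq]
    field_simp
    exact hs2.symm
  -- The codebook bound holds for each fixed `ω`, so shared randomness does not help.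
  have hkey : ∫ ω, ∑ σ, ⟪V ω (q ω σ), signVector σ⟫ ∂P ≤
      ∫ ω, (t / 2 * ∑ σ, ‖V ω (q ω σ)‖ ^ 2 + 13 * L * 2 ^ d / (2 * t)) ∂P := by
    refine integral_mono ?_ ?_ fun ω => sum_inner_signVector_codeword_le hι (V ω) (q ω) ht0
    · exact integrable_finsetSum _ fun σ _ => (hint σ).inner_const _
    · exact ((integrable_finsetSum _ fun σ _ => hint2 σ).const_mul _).add (integrable_const _)
  rw [integral_finsetSum _ fun σ _ => (hint σ).inner_const _,
    integral_add ((integrable_finsetSum _ fun σ _ => hint2 σ).const_mul _) (integrable_const _),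
    integral_const_mul, integral_finsetSum _ fun σ _ => hint2 σ] at hkey
  simp_rw [hinner] at hkey
  have hsum : ∑ σ : Fin d → Bool, ∫ ω, ‖V ω (q ω σ)‖ ^ 2 ∂P ≤ 2 ^ d * M := by
    refine (Finset.sum_le_sum fun σ _ => hM σ).trans_eq ?_
    simp
  have hkey' : 2 ^ d * (G * √d) ≤ t / 2 * (2 ^ d * M) + 13 * L * 2 ^ d / (2 * t) := by
    refine le_trans ?_ (hkey.trans (add_le_add (mul_le_mul_of_nonneg_left hsum ?_) ?_))
    · simp
    · positivity
    · simp
  have hpow : (0 : ℝ) < 2 ^ d := by positivity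
  have h1 : G * √d ≤ t / 2 * M + 13 * L / (2 * t) := by
    refine le_of_mul_le_mul_left (hkey'.trans_eq ?_) hpow
    ring
  have h2 : 13 * L / (2 * t) = G * √d / 2 := by
    rw [ht]
    field_simp
  have h3 : G * √d ≤ 13 * L / (G * √d) * M := by
    rw [h2] at h1
    rw [← ht]
    linarith
  rw [div_mul_eq_mul_div, le_div_iff₀ (by positivity)] at h3
  nlinarith

/-! ### Identical clients: point masses as data distributions -/

lemma dirac_mem_boundedDistributions {d : ℕ} {G : ℝ} {z : EuclideanSpace ℝ (Fin d)}
    (hz : ‖z‖ ≤ G) : Measure.dirac z ∈ boundedDistributions d G :=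
  ⟨inferInstance, by rw [ae_dirac_eq]; exact hz⟩

lemma distMean_dirac {d : ℕ} (z : EuclideanSpace ℝ (Fin d)) :
    distMean (Measure.dirac z) = z := by
  simp [distMean]

lemma runLaw_dirac {Ω : Type u} [MeasurableSpace Ω] (P : Measure Ω) [IsProbabilityMeasure P]
    (n : ℕ) {d : ℕ} (z : EuclideanSpace ℝ (Fin d)) :
    runLaw P n (Measure.dirac z) = P.map fun ω => (ω, fun _ => z) := by
  have h : (Measure.pi fun _ : Fin n => Measure.dirac z) = Measure.dirac fun _ => z := by
    refine Measure.pi_eq fun s hs => ?_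
    rw [Measure.dirac_apply' _ (MeasurableSet.univ_pi hs)]
    simp_rw [Measure.dirac_apply' _ (hs _)]
    by_cases hz : ∀ i, z ∈ s i
    · simp [Set.indicator, hz]
    · push Not at hz
      obtain ⟨i, hi⟩ := hz
      rw [Finset.prod_eq_zero (Finset.mem_univ i) (by simp [hi]),
        Set.indicator_of_notMem fun h => hi (Set.mem_univ_pi.1 h i)]
  rw [runLaw, h, Measure.prod_dirac]

namespace SecAggProtocol

variable {Ω : Type u} [MeasurableSpace Ω] {P : Measure Ω}
  {n d K : ℕ} {G : ℝ}

/-- When all clients hold the same vector `z`, the output of an unbiased protocol is integrable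
with mean `z`. -/
lemma Unbiased.integral_output [IsProbabilityMeasure P] {A : SecAggProtocol Ω n d K} (hA : A.Unbiased P G)
    {z : EuclideanSpace ℝ (Fin d)} (hz : ‖z‖ ≤ G) :
    Integrable (fun ω => A.output ω fun _ => z) P ∧ ∫ ω, A.output ω (fun _ => z) ∂P = z := by
  obtain ⟨h1, h2⟩ := hA _ (dirac_mem_boundedDistributions hz)
  have hm : Measurable fun ω : Ω => (ω, fun _ : Fin n => z) := measurable_prodMk_right
  rw [runLaw_dirac, distMean_dirac] at h2
  rw [runLaw_dirac] at h1
  rw [integral_map hm.aemeasurable h1.aestronglyMeasurable] at h2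
  exact ⟨(integrable_map_measure h1.aestronglyMeasurable hm.aemeasurable).1 h1, h2⟩

/-- An unbiased protocol cannot ignore the data. -/
lemma Unbiased.not_output_const [IsProbabilityMeasure P] {A : SecAggProtocol Ω n d K} (hA : A.Unbiased P G)
    (hd : 1 ≤ d) (hG : 0 < G) : ¬ ∀ ω z z', A.output ω z = A.output ω z' := by
  intro h
  have : Nonempty (Fin d) := ⟨⟨0, hd⟩⟩
  obtain ⟨v, hv⟩ := exists_norm_eq (EuclideanSpace ℝ (Fin d)) hG.le
  have h0 := (hA.integral_output (z := 0) (by simpa using hG.le)).2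
  have h1 := (hA.integral_output hv.le).2
  simp_rw [h _ (fun _ => v) (fun _ => 0)] at h1
  rw [h0] at h1
  rw [← h1, norm_zero] at hv
  exact hG.ne hv

/-- The second moment of the output of an unbiased protocol when all clients hold `z`. -/
lemma Unbiased.integral_norm_sq_le [IsProbabilityMeasure P] {A : SecAggProtocol Ω n d K} (hA : A.Unbiased P G)
    {z : EuclideanSpace ℝ (Fin d)} (hz : ‖z‖ ≤ G) {E : ℝ} (hE : 0 ≤ E)
    (hmse : A.mse P (Measure.dirac z) ≤ ENNReal.ofReal E) :
    Integrable (fun ω => ‖A.output ω fun _ => z‖ ^ 2) P ∧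
      ∫ ω, ‖A.output ω fun _ => z‖ ^ 2 ∂P ≤ 2 * E + 2 * G ^ 2 := by
  have hi := (hA.integral_output hz).1
  have hm : Measurable fun ω : Ω => (ω, fun _ : Fin n => z) := measurable_prodMk_right
  have hae := (hA _ (dirac_mem_boundedDistributions hz)).1.aestronglyMeasurable
  rw [runLaw_dirac] at hae
  have haem : AEMeasurable (fun x : Ω × (Fin n → EuclideanSpace ℝ (Fin d)) =>
      ENNReal.ofReal (‖A.output x.1 x.2 - z‖ ^ 2)) (P.map fun ω => (ω, fun _ => z)) :=
    ((hae.sub aestronglyMeasurable_const).norm.pow 2).aemeasurable.ennreal_ofReal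
  rw [mse, runLaw_dirac, distMean_dirac, lintegral_map' haem hm.aemeasurable] at hmse
  have hmeas : AEStronglyMeasurable (fun ω => ‖A.output ω (fun _ => z) - z‖ ^ 2) P :=
    (hi.aestronglyMeasurable.sub aestronglyMeasurable_const).norm.pow 2
  have hint : Integrable (fun ω => ‖A.output ω (fun _ => z) - z‖ ^ 2) P :=
    (lintegral_ofReal_ne_top_iff_integrable hmeas (.of_forall fun _ => by positivity)).1
      (hmse.trans_lt ENNReal.ofReal_lt_top).ne
  have hle : ∫ ω, ‖A.output ω (fun _ => z) - z‖ ^ 2 ∂P ≤ E := by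
    rw [integral_eq_lintegral_of_nonneg_ae (.of_forall fun _ => by positivity) hmeas]
    exact ENNReal.toReal_le_of_le_ofReal hE hmse
  have hpt : ∀ ω, ‖A.output ω fun _ => z‖ ^ 2 ≤
      2 * ‖A.output ω (fun _ => z) - z‖ ^ 2 + 2 * G ^ 2 := fun ω => by
    have h1 := norm_add_le (A.output ω (fun _ => z) - z) z
    rw [sub_add_cancel] at h1
    have h2 : ‖A.output ω fun _ => z‖ ≤ ‖A.output ω (fun _ => z) - z‖ + G := by linarith
    have h3 := pow_le_pow_left₀ (norm_nonneg _) h2 2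
    nlinarith [sq_nonneg (‖A.output ω (fun _ => z) - z‖ - G)]
  have hdom := (hint.const_mul 2).add (integrable_const (μ := P) (2 * G ^ 2))
  have hi2 : Integrable (fun ω => ‖A.output ω fun _ => z‖ ^ 2) P :=
    hdom.mono' (hi.aestronglyMeasurable.norm.pow 2) (.of_forall fun ω => by
      rw [Real.norm_of_nonneg (by positivity)]
      exact hpt ω)
  refine ⟨hi2, (integral_mono hi2 hdom hpt).trans ?_⟩
  simp only [Pi.add_apply]
  rw [integral_add (hint.const_mul 2) (integrable_const _), integral_const_mul]
  simp
  linarith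

/-! ### Protocols with at most one round -/

lemma output_eq_of_zero_rounds (A : SecAggProtocol Ω n d 0) (ω : Ω)
    (z z' : Fin n → EuclideanSpace ℝ (Fin d)) : A.output ω z = A.output ω z' := by
  cases A
  rfl

lemma bits_eq_zero_of_zero_rounds (A : SecAggProtocol Ω n d 0) (ω : Ω)
    (z : Fin n → EuclideanSpace ℝ (Fin d)) : A.bits ω z = 0 := by
  cases A
  rfl

/-- The size of the message space of a one-round protocol is fixed, so a bound on the
communication that holds with positive probability holds always. -/
lemma logb_card_le_of_probBitsLE_pos {O : Type} [AddCommGroup O] [Fintype O]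
    {enc : Fin n → Ω → EuclideanSpace ℝ (Fin d) → O}
    {henc : ∀ i o, MeasurableSet {p : Ω × EuclideanSpace ℝ (Fin d) | enc i p.1 p.2 = o}}
    {next : O → SecAggProtocol Ω n d 0} {D : Measure (EuclideanSpace ℝ (Fin d))} {b : ℝ}
    (h : 0 < (round O enc henc next).probBitsLE P D b) :
    Real.logb 2 (Fintype.card O) ≤ b := by
  by_contra hb
  have : {x : Ω × (Fin n → EuclideanSpace ℝ (Fin d)) |
      (round O enc henc next).bits x.1 x.2 ≤ b} = ∅ := by
    refine Set.eq_empty_of_forall_notMem fun x hx => hb ?_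
    rwa [Set.mem_ofPred_eq, bits, bits_eq_zero_of_zero_rounds, add_zero] at hx
  rw [probBitsLE, this, measureReal_empty] at h
  exact h.false

/-- An unbiased one-round protocol has a nontrivial message space. -/
lemma two_le_card_of_unbiased [IsProbabilityMeasure P] {O : Type} [AddCommGroup O] [Fintype O]
    {enc : Fin n → Ω → EuclideanSpace ℝ (Fin d) → O}
    {henc : ∀ i o, MeasurableSet {p : Ω × EuclideanSpace ℝ (Fin d) | enc i p.1 p.2 = o}}
    {next : O → SecAggProtocol Ω n d 0} (hA : (round O enc henc next).Unbiased P G)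
    (hd : 1 ≤ d) (hG : 0 < G) : 2 ≤ Fintype.card O := by
  by_contra hO
  have : Subsingleton O := Fintype.card_le_one_iff_subsingleton.1 (by omega)
  refine hA.not_output_const hd hG fun ω z z' => ?_
  rw [output, output, Subsingleton.elim (∑ i, enc i ω (z i)) (∑ i, enc i ω (z' i))]
  exact output_eq_of_zero_rounds _ _ _ _

/-- An unbiased one-round protocol with mean squared error at most `E` needs a message space with
`log |O| ≥ G² d / (26 (E + G²))`. -/
lemma sq_mul_le_log_card_mul_of_unbiased [IsProbabilityMeasure P] {O : Type} [AddCommGroup O] [Fintype O]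
    {enc : Fin n → Ω → EuclideanSpace ℝ (Fin d) → O}
    {henc : ∀ i o, MeasurableSet {p : Ω × EuclideanSpace ℝ (Fin d) | enc i p.1 p.2 = o}}
    {next : O → SecAggProtocol Ω n d 0} (hA : (round O enc henc next).Unbiased P G)
    (hd : 1 ≤ d) (hG : 0 < G) {E : ℝ} (hE : 0 ≤ E)
    (hmse : ∀ D ∈ boundedDistributions d G,
      (round O enc henc next).mse P D ≤ ENNReal.ofReal E) :
    G ^ 2 * d ≤ 26 * Real.log (Fintype.card O) * (E + G ^ 2) := by
  have hd0 : (0 : ℝ) < d := by exact_mod_cast hd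
  have hs0 : 0 < √(d : ℝ) := Real.sqrt_pos.2 hd0
  set x : (Fin d → Bool) → EuclideanSpace ℝ (Fin d) := fun σ => (G / √d) • signVector σ with hx
  have hxn : ∀ σ, ‖x σ‖ ≤ G := fun σ => by
    have h : ‖signVector σ‖ = √d := by
      rw [← norm_signVector_sq σ, Real.sqrt_sq (norm_nonneg _)]
    rw [hx, norm_smul, h, Real.norm_of_nonneg (by positivity), div_mul_cancel₀ _ hs0.ne']
  -- After the single round the decoder no longer sees the data, so the dummy dataset `0` defines
  -- the codeword of each aggregate.
  have hout : ∀ σ ω, (next (∑ i, enc i ω (x σ))).output ω 0 =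
      (round O enc henc next).output ω fun _ => x σ :=
    fun σ ω => output_eq_of_zero_rounds _ _ _ _
  have hmom := fun σ =>
    hA.integral_norm_sq_le (hxn σ) hE (hmse _ (dirac_mem_boundedDistributions (hxn σ)))
  have := sq_mul_le_of_unbiased_quantizer (P := P) hd hG (two_le_card_of_unbiased hA hd hG)
    (fun ω o => (next o).output ω 0) (fun ω σ => ∑ i, enc i ω (x σ))
    (M := 2 * E + 2 * G ^ 2)
    (fun σ => by simpa only [hout] using (hA.integral_output (hxn σ)).1)
    (fun σ => by simpa only [hout] using (hA.integral_output (hxn σ)).2)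
    (fun σ => by simpa only [hout] using (hmom σ).1)
    (fun σ => by simpa only [hout] using (hmom σ).2)
  linarith

end SecAggProtocol

/-! ### Error rate, budget and conclusion -/

lemma commBudget_zero (d n : ℕ) (ε δ : ℝ) : commBudget d n ε δ 0 = 0 := by
  simp [commBudget]

lemma errorRate_nonneg (d n : ℕ) (G ε : ℝ) {δ : ℝ} (hδ : 0 < δ) (hδ1 : δ < 1) :
    0 ≤ errorRate d n G ε δ := by
  have : 0 ≤ Real.log (1 / δ) := Real.log_nonneg (by rw [le_div_iff₀ hδ]; linarith)
  unfold errorRate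
  positivity

/-- The product of the error rate and the worst-case budget is at most `2 G² d`. -/
lemma errorRate_mul_commBudget_le {d n : ℕ} (hn : 2 ≤ n) (G : ℝ) {ε δ : ℝ} (hε : 0 < ε)
    (hδ : 0 < δ) (hδ1 : δ < 1) :
    errorRate d n G ε δ * commBudget d n ε δ 1 ≤ 2 * (G ^ 2 * d) := by
  have hL : 0 < Real.log (1 / δ) := Real.log_pos (by rw [lt_div_iff₀ hδ]; linarith)
  have hn1 : (1 : ℝ) ≤ n := by exact_mod_cast (by omega : 1 ≤ n)
  have h1 : commBudget d n ε δ 1 ≤ d := min_le_left _ _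
  -- This entry of the minimum cancels the privacy term of the error rate; the entry `d` handles the
  -- sampling term.
  have h2 : commBudget d n ε δ 1 ≤ n ^ 2 * ε ^ 2 / Real.log (1 / δ) := by
    refine (min_le_right _ _).trans ((min_le_left _ _).trans_eq ?_)
    ring
  have h3 : G ^ 2 / n * commBudget d n ε δ 1 ≤ G ^ 2 * d :=
    mul_le_mul (div_le_self (sq_nonneg G) hn1) h1
      (by unfold commBudget; positivity) (sq_nonneg G)
  have h4 : G ^ 2 * d * Real.log (1 / δ) / (n ^ 2 * ε ^ 2) * commBudget d n ε δ 1 ≤ G ^ 2 * d := by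
    refine (mul_le_mul_of_nonneg_left h2 (by positivity)).trans_eq ?_
    field_simp
  rw [errorRate, add_mul]
  linarith

/-- First part: a `K`-round unbiased protocol with error `O(min (‖μ‖², errorRate))` and, with
probability `> 1/n`, communication `O(commBudget ‖μ‖)`, pointwise for all bounded distributions,
has `K ≥ 2`.  Second part, under weaker hypotheses that protocols with two rounds can meet: the
error is only asked to be `O(errorRate)`, and up to `s` additional bits are allowed, where `s` is
less than a fixed fraction of the worst-case budget (the one for `‖μ‖ = G`). -/
theorem mainTheorem3 :
    (∀ (K d n : ℕ) (G ε δ : ℝ), 1 ≤ d → 2 ≤ n → 0 < G → 0 < ε → 0 < δ →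
      ∀ (Ω : Type u) [MeasurableSpace Ω] (P : Measure Ω) [IsProbabilityMeasure P]
        (A : SecAggProtocol Ω n d K) (C₁ C₂ : ℝ),
        A.Unbiased P G →
        (∀ D ∈ boundedDistributions d G,
          A.mse P D ≤
            ENNReal.ofReal (C₁ * min (‖distMean D‖ ^ 2) (errorRate d n G ε δ))) →
        (∀ D ∈ boundedDistributions d G,
          1 / (n : ℝ) < A.probBitsLE P D (C₂ * commBudget d n ε δ ‖distMean D‖)) →
        2 ≤ K) ∧
    (∃ c : ℝ, 0 < c ∧
      ∀ (K d n : ℕ) (G ε δ : ℝ), 1 ≤ d → 2 ≤ n → 0 < G → 0 < ε → 0 < δ → δ < 1 →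
      ∀ (Ω : Type u) [MeasurableSpace Ω] (P : Measure Ω) [IsProbabilityMeasure P]
        (A : SecAggProtocol Ω n d K) (C₁ C₂ s : ℝ),
        1 ≤ C₁ →
        s < c / C₁ * commBudget d n ε δ 1 →
        A.Unbiased P G →
        (∀ D ∈ boundedDistributions d G,
          A.mse P D ≤ ENNReal.ofReal (C₁ * errorRate d n G ε δ)) →
        (∀ D ∈ boundedDistributions d G,
          1 / (n : ℝ) < A.probBitsLE P D (C₂ * commBudget d n ε δ (‖distMean D‖ / G) + s)) →
        2 ≤ K) := by
  -- Any `c < 1 / 78` would do: the final estimate loses a factor `26 * (2 + 1)`.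
  refine ⟨?_, 1 / 100, by norm_num, ?_⟩
  · intro K d n G ε δ hd hn hG _ _ Ω _ P _ A C₁ C₂ hA _ hbits
    by_contra hK
    have hbits0 := hbits _ (dirac_mem_boundedDistributions (z := 0) (by simpa using hG.le))
    rw [distMean_dirac, norm_zero, commBudget_zero, mul_zero] at hbits0
    have hpos := lt_of_le_of_lt (by positivity) hbits0
    obtain rfl | rfl : K = 0 ∨ K = 1 := by omega
    · exact hA.not_output_const hd hG A.output_eq_of_zero_rounds
    · cases A with
      | round O enc henc next =>
        have hcard := SecAggProtocol.two_le_card_of_unbiased hA hd hG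
        have hlog := SecAggProtocol.logb_card_le_of_probBitsLE_pos hpos
        exact hlog.not_gt (Real.logb_pos one_lt_two (by exact_mod_cast hcard))
  · intro K d n G ε δ hd hn hG hε hδ hδ1 Ω _ P _ A C₁ C₂ s hC₁ hs hA hmse hbits
    by_contra hK
    have hbits0 := hbits _ (dirac_mem_boundedDistributions (z := 0) (by simpa using hG.le))
    rw [distMean_dirac, norm_zero, zero_div, commBudget_zero, mul_zero, zero_add] at hbits0
    have hpos := lt_of_le_of_lt (by positivity) hbits0
    obtain rfl | rfl : K = 0 ∨ K = 1 := by omega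
    · exact hA.not_output_const hd hG A.output_eq_of_zero_rounds
    · cases A with
      | round O enc henc next =>
        have hcard := SecAggProtocol.two_le_card_of_unbiased hA hd hG
        have hlog := SecAggProtocol.logb_card_le_of_probBitsLE_pos hpos
        have hα := errorRate_nonneg d n G ε hδ hδ1
        have hkey := SecAggProtocol.sq_mul_le_log_card_mul_of_unbiased hA hd hG
          (mul_nonneg (zero_le_one.trans hC₁) hα) hmse
        have hαB := errorRate_mul_commBudget_le (d := d) hn G hε hδ hδ1
        have hBd : commBudget d n ε δ 1 ≤ d := min_le_left _ _
        set L := Real.log (Fintype.card O)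
        set B := commBudget d n ε δ 1
        set α := errorRate d n G ε δ
        have hL0 : 0 < L := Real.log_pos (by exact_mod_cast hcard)
        -- Natural logarithms are at most binary ones, as `log 2 < 1`.
        have hLs : L ≤ s := by
          refine le_trans ?_ hlog
          rw [Real.logb, le_div_iff₀ (Real.log_pos one_lt_two)]
          have := Real.log_two_lt_d9
          nlinarith
        have hLB : L * C₁ ≤ B / 100 := by
          have h := (hLs.trans_lt hs).le
          rw [div_mul_eq_mul_div, le_div_iff₀ (by linarith)] at h
          linarith
        have hG2 : 0 < G ^ 2 := by positivity
        have hd0 : (0 : ℝ) < d := by exact_mod_cast hd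
        have h1 : L * (C₁ * α + G ^ 2) ≤ L * C₁ * (α + G ^ 2) := by
          nlinarith [mul_nonneg (mul_nonneg hL0.le hG2.le) (sub_nonneg.2 hC₁)]
        have h2 : L * C₁ * (α + G ^ 2) ≤ B / 100 * (α + G ^ 2) :=
          mul_le_mul_of_nonneg_right hLB (by positivity)
        have h3 : G ^ 2 * B ≤ G ^ 2 * d := mul_le_mul_of_nonneg_left hBd hG2.le
        -- The chain is `G² d ≤ 26 L (C₁ α + G²) ≤ (26 / 100) (α B + G² B) ≤ (78 / 100) G² d`, which
        -- is absurd.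
        nlinarith [mul_pos hG2 hd0]
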